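/- Let $F$ be a field of characteristic $2$ and let $K=F(t_1,t_2,\dots)$ be the field of rational functions in countably many indeterminates over $F$; the field $K$ is not perfect. There is an abelian restricted Lie algebra $L$ over $K$ (with power mapping $z\mapsto z^{[2]}$) having a $K$-basis $x,y_1,y_2,\dots$ with $$x^{[2]}=x,\qquad y_i^{[2]}=t_i x\quad (i\ge 1),$$ so that $L$ is infinite-dimensional, and such that: 1. $L$ is locally finite-dimensional, i.e. every finitely generated restricted subalgebra of $L$ is finite-dimensional; 2. the restricted enveloping algebra $u(L)$ is semiperfect, i.e. $u(L)/\mathcal J(u(L))$ is Artinian and idempotents of $u(L)/\mathcal J(u(L))$ can be lifted to $u(L)$, where $\mathcal J$ denotes the Jacobson radical; 3. $\mathcal O_2(L)=0$, where $\mathcal O_2(L)$ is the sum of all restricted ideals $I$ of $L$ that are $2$-nil, meaning that every element of $I$ is sent to $0$ by some iterate of the power mapping. In particular $\mathcal O_2(L)$ has infinite codimension in $L$. Hence over a field that is not perfect, an abelian (even locally finite-dimensional) restricted Lie algebra $L$ of characteristic $p>0$ can have $u(L)$ semiperfect although $\mathcal O_p(L)$ has infinite codimension in $L$. -/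

import Mathlib

universe u v

/-! ### Restricted Lie algebras -/

/-- `lieAdPowCoeff a b n j` is the coefficient of `X ^ j` in `(ad (a X + b)) ^ n (a)`,
computed in the polynomial Lie algebra `L[X]`. -/
def lieAdPowCoeff {L : Type v} [LieRing L] (a b : L) : ℕ → ℕ → L
  | 0, 0 => a
  | 0, _ + 1 => 0
  | n + 1, 0 => ⁅b, lieAdPowCoeff a b n 0⁆
  | n + 1, j + 1 => ⁅b, lieAdPowCoeff a b n (j + 1)⁆ + ⁅a, lieAdPowCoeff a b n j⁆

/-- A restricted Lie algebra over a field `K` of characteristic `p > 0`: a Lie algebra with a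
power mapping `x ↦ x^[p]` satisfying Jacobson's axioms. In the last axiom the sum is over
`s_i(a, b)`, `1 ≤ i ≤ p - 1`, where `i s_i(a, b)` is the coefficient of `X ^ (i - 1)` in
`(ad (a X + b)) ^ (p - 1) (a)`. -/
class RestrictedLieAlgebra (p : ℕ) [Fact p.Prime] (K : Type u) [Field K] [CharP K p]
    (L : Type v) [LieRing L] [LieAlgebra K L] where
  /-- The power mapping `x ↦ x^[p]`. -/
  pmap : L → L
  ad_pmap : ∀ x : L, LieAlgebra.ad K L (pmap x) = LieAlgebra.ad K L x ^ p
  pmap_smul : ∀ (c : K) (x : L), pmap (c • x) = c ^ p • pmap x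
  pmap_add : ∀ a b : L, pmap (a + b) = pmap a + pmap b +
    ∑ i ∈ Finset.Icc 1 (p - 1), ((i : K)⁻¹) • lieAdPowCoeff a b (p - 1) (i - 1)

namespace RestrictedLieAlgebra

variable (p : ℕ) [Fact p.Prime] (K : Type u) [Field K] [CharP K p]
  (L : Type v) [LieRing L] [LieAlgebra K L] [RestrictedLieAlgebra p K L]

/-- An element is `p`-nilpotent if some iterate of the power mapping kills it. -/
def IsPNilpotent (x : L) : Prop :=
  ∃ n : ℕ, (pmap p K : L → L)^[n] x = 0

/-- `O_p(L)`: the sum of all `p`-nil restricted ideals of `L`. -/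
noncomputable def pCore : LieIdeal K L :=
  sSup {I : LieIdeal K L | (∀ x ∈ I, pmap p K x ∈ I) ∧ ∀ x ∈ I, IsPNilpotent p K L x}

/-- The restricted subalgebra of `L` generated by a subset. -/
noncomputable def restrictedSpan (s : Set L) : LieSubalgebra K L :=
  sInf {H : LieSubalgebra K L | s ⊆ H ∧ ∀ x ∈ H, pmap p K x ∈ H}

/-- Every finitely generated restricted subalgebra is finite-dimensional. -/
def IsLocallyFiniteDimensional : Prop :=
  ∀ s : Set L, s.Finite → Module.Finite K (restrictedSpan p K L s)

/-- The relations `x ^ p = x^[p]`, for `x` in `L`, on the universal enveloping algebra. -/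
inductive EnvelopingRel :
    UniversalEnvelopingAlgebra K L → UniversalEnvelopingAlgebra K L → Prop
  | pow_eq (x : L) : EnvelopingRel (UniversalEnvelopingAlgebra.ι K x ^ p)
      (UniversalEnvelopingAlgebra.ι K (pmap p K x))

/-- The restricted enveloping algebra `u(L)`: the quotient of `U(L)` by the two-sided ideal
generated by the elements `x ^ p - x^[p]`, for `x` in `L`. -/
abbrev RestrictedEnvelopingAlgebra : Type (max u v) :=
  RingQuot (EnvelopingRel p K L)

end RestrictedLieAlgebra

/-! ### Semiperfect rings -/

/-- A ring `R` with Jacobson radical `J` is semiperfect if `R / J` is Artinian and idempotents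
of `R / J` can be lifted to `R`. -/
def IsSemiperfectRing (R : Type u) [Ring R] : Prop :=
  IsArtinianRing (R ⧸ Ring.jacobson R) ∧
  ∀ e : R ⧸ Ring.jacobson R, IsIdempotentElem e →
    ∃ f : R, IsIdempotentElem f ∧ Ideal.Quotient.mk (Ring.jacobson R) f = e

/-! ### The ground field -/

/-- The field `F(t_0, t_1, …)` of rational functions in countably many indeterminates. -/
abbrev RatFuncNat (F : Type u) [Field F] : Type u := FractionRing (MvPolynomial ℕ F)

/-- The indeterminate `t_i`. -/
noncomputable def RatFuncNat.t (F : Type u) [Field F] (i : ℕ) : RatFuncNat F :=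
  algebraMap (MvPolynomial ℕ F) (RatFuncNat F) (MvPolynomial.X i)

instance RatFuncNat.instCharP (F : Type u) [Field F] (p : ℕ) [CharP F p] :
    CharP (RatFuncNat F) p :=
  charP_of_injective_algebraMap (algebraMap F (RatFuncNat F)).injective p

/-! Write `z^[2] = q(z) x` with `q(∑ aᵢ eᵢ) = ∑ aᵢ² sᵢ` and `s = (1, t_0, t_1, …)`. Everything rests
on two facts. The power mapping takes values in the line through `x`, and `x` is an idempotent of
the commutative ring `u(L)`. Squaring is additive in characteristic 2, so every square lies in `K(1
- x) + Kx`. Hence `u(L)` has at most two maximal ideals, and squares of representatives lift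
idempotents. The form `q` is anisotropic, because partial derivatives show that the `sᵢ` are
independent over `K²` (`eq_zero_of_diagForm_eq_zero`). So no iterate of the power mapping kills a
nonzero element, and `t_0` has no square root. -/

section Semiperfect

/-! ### Rings whose squares lie in the span of two complementary idempotents -/

variable {K R : Type*} [Field K] [CommRing R] [Algebra K R] {x : R}

/-- If an algebra is covered, up to squaring, by the span of two complementary idempotents, then
each of them lies outside at most one maximal ideal. -/
theorem Ideal.IsMaximal.eq_of_sq_mem_span_idempotents
    (h : ∀ r : R, ∃ γ δ : K, r ^ 2 = γ • (1 - x) + δ • x)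
    {M N : Ideal R} (hM : M.IsMaximal) (hN : N.IsMaximal) (hxM : x ∈ M) (hxN : x ∈ N) :
    M = N := by
  refine hM.eq_of_le hN.ne_top fun r hr => ?_
  obtain ⟨γ, δ, hr2⟩ := h r
  have hδM (P : Ideal R) (hP : x ∈ P) : δ • x ∈ P := Submodule.smul_of_tower_mem P δ hP
  -- Otherwise `M` contains both `x` and `1 - x`. With `γ = 0`, `r ^ 2` is a multiple of `x`, hence
  -- lies in the prime `N`.
  have hγ : γ = 0 := by
    by_contra hγ
    have h1 : γ • (1 - x) ∈ M := by
      rw [← add_sub_cancel_right (γ • (1 - x)) (δ • x), ← hr2]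
      exact sub_mem (Ideal.pow_mem_of_mem _ hr 2 two_pos) (hδM M hxM)
    have h2 : 1 - x ∈ M := by
      simpa [smul_smul, hγ] using Submodule.smul_of_tower_mem M γ⁻¹ h1
    exact hM.ne_top ((Ideal.eq_top_iff_one _).2 (by simpa using add_mem h2 hxM))
  refine hN.isPrime.mem_of_pow_mem 2 ?_
  rw [hr2, hγ, zero_smul, zero_add]
  exact hδM N hxN

/-- As `x(1 - x) = 0`, each maximal ideal contains `x` or `1 - x`, and which of the two it contains
determines it. -/
theorem MaximalSpectrum.finite_of_sq_mem_span_idempotents (hx : x * x = x)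
    (h : ∀ r : R, ∃ γ δ : K, r ^ 2 = γ • (1 - x) + δ • x) : Finite (MaximalSpectrum R) := by
  classical
  refine Finite.of_injective (β := Prop) (fun M => x ∈ M.asIdeal) fun M N hMN => ?_
  have h' : ∀ r : R, ∃ γ δ : K, r ^ 2 = γ • (1 - (1 - x)) + δ • (1 - x) := fun r => by
    obtain ⟨γ, δ, hr⟩ := h r
    exact ⟨δ, γ, by rw [hr, sub_sub_cancel, add_comm]⟩
  have key (P : MaximalSpectrum R) (hP : x ∉ P.asIdeal) : 1 - x ∈ P.asIdeal :=
    (P.isMaximal.isPrime.mem_or_mem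
      (show x * (1 - x) ∈ P.asIdeal by rw [mul_sub, mul_one, hx, sub_self]; exact zero_mem _)
      ).resolve_left hP
  apply MaximalSpectrum.ext
  by_cases hM : x ∈ M.asIdeal
  · exact M.isMaximal.eq_of_sq_mem_span_idempotents h N.isMaximal hM (hMN.mp hM)
  · exact M.isMaximal.eq_of_sq_mem_span_idempotents h' N.isMaximal (key M hM)
      (key N fun hN => hM (hMN.mpr hN))

/-- Chinese remainder theorem: the quotient is a finite product of fields. -/
theorem IsArtinianRing.quotient_jacobson_of_finite_maximalSpectrum (R : Type*) [CommRing R]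
    [Finite (MaximalSpectrum R)] : IsArtinianRing (R ⧸ Ring.jacobson R) := by
  have hJ : Ring.jacobson R = ⨅ M : MaximalSpectrum R, M.asIdeal := by
    rw [← Ideal.jacobson_bot]
    refine le_antisymm (le_iInf fun M => sInf_le ⟨bot_le, M.isMaximal⟩)
      (le_sInf fun M hM => iInf_le_of_le ⟨M, hM.2⟩ le_rfl)
  have e := Ideal.quotientInfRingEquivPiQuotient (fun M : MaximalSpectrum R => M.asIdeal)
    fun M N hMN => Ideal.isCoprime_of_isMaximal fun h => hMN (MaximalSpectrum.ext h)
  have (M : MaximalSpectrum R) : IsArtinianRing (R ⧸ M.asIdeal) :=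
    letI := Ideal.Quotient.field M.asIdeal
    inferInstance
  rw [hJ]
  exact e.symm.isArtinianRing

theorem IsIdempotentElem.eq_zero_of_mem_jacobson {R : Type*} [CommRing R] {a : R}
    (ha : IsIdempotentElem a) (h : a ∈ Ring.jacobson R) : a = 0 := by
  rw [← Ideal.jacobson_bot, Ideal.mem_jacobson_bot] at h
  have h1 : IsUnit (1 - a) := by simpa [sub_eq_neg_add] using h (-1)
  exact (h1.mul_right_eq_zero).1 ha.one_sub_mul_self

/-- The lift of the class of `r` is `r ^ 2`. Its defect from idempotency lies in the radical;
multiplying by `1 - x` and by `x` puts both components there, and a scalar multiple of an idempotent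
in the radical vanishes. -/
theorem isSemiperfectRing_of_sq_mem_span_idempotents {K : Type*} {R : Type u} [Field K]
    [CommRing R] [Algebra K R] {x : R} (hx : x * x = x)
    (h : ∀ r : R, ∃ γ δ : K, r ^ 2 = γ • (1 - x) + δ • x) : IsSemiperfectRing R := by
  have hfin := MaximalSpectrum.finite_of_sq_mem_span_idempotents hx h
  refine ⟨IsArtinianRing.quotient_jacobson_of_finite_maximalSpectrum R, fun e he => ?_⟩
  obtain ⟨r, rfl⟩ := Ideal.Quotient.mk_surjective e
  obtain ⟨γ, δ, hr⟩ := h r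
  have hmk : Ideal.Quotient.mk (Ring.jacobson R) (r ^ 2) = Ideal.Quotient.mk _ r := by
    rw [map_pow, pow_two]
    exact he
  have hxi : IsIdempotentElem x := hx
  have hmem : (r ^ 2) * r ^ 2 - r ^ 2 ∈ Ring.jacobson R := by
    rw [← Ideal.Quotient.eq, map_mul, hmk]
    exact he
  have hexp : (r ^ 2) * r ^ 2 - r ^ 2 = (γ * γ - γ) • (1 - x) + (δ * δ - δ) • x := by
    rw [hr]
    simp only [Algebra.smul_def, map_sub, map_mul]
    linear_combination ((algebraMap K R γ - algebraMap K R δ) ^ 2) * hx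
  have kill (c : K) (y : R) (hy : IsIdempotentElem y) (hc : c • y ∈ Ring.jacobson R) :
      c • y = 0 := by
    by_cases hc0 : c = 0
    · rw [hc0, zero_smul]
    · have : y ∈ Ring.jacobson R := by
        simpa [smul_smul, hc0] using Submodule.smul_of_tower_mem (Ring.jacobson R) c⁻¹ hc
      rw [hy.eq_zero_of_mem_jacobson this, smul_zero]
  refine ⟨r ^ 2, ?_, hmk⟩
  have h1 := Ideal.mul_mem_right (1 - x) _ hmem
  have h2 := Ideal.mul_mem_right x _ hmem
  rw [hexp, add_mul, smul_mul_assoc, smul_mul_assoc, hxi.one_sub.eq, hxi.mul_one_sub_self,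
    smul_zero, add_zero] at h1
  rw [hexp, add_mul, smul_mul_assoc, smul_mul_assoc, hxi.eq, hxi.one_sub_mul_self,
    smul_zero, zero_add] at h2
  have h0 := hexp
  rw [kill _ _ hxi.one_sub h1, kill _ _ hxi h2, add_zero] at h0
  exact sub_eq_zero.1 h0

theorem isSemiperfectRing_of_commute_of_sq_mem_span_idempotents {K : Type*} {R : Type u} [Field K]
    [Ring R] [Algebra K R] (hcomm : ∀ a b : R, a * b = b * a) {x : R} (hx : x * x = x)
    (h : ∀ r : R, ∃ γ δ : K, r ^ 2 = γ • (1 - x) + δ • x) : IsSemiperfectRing R :=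
  letI : CommRing R := CommRing.mk hcomm
  isSemiperfectRing_of_sq_mem_span_idempotents hx h

end Semiperfect

/-! ### The restricted enveloping algebra -/

namespace RestrictedLieAlgebra

section Enveloping

attribute [local instance] LieRing.ofAssociativeRing LieAlgebra.ofAssociativeAlgebra

variable (p : ℕ) [Fact p.Prime] (K : Type u) [Field K] [CharP K p]
  (L : Type v) [LieRing L] [LieAlgebra K L] [RestrictedLieAlgebra p K L]

/-- The canonical map from a restricted Lie algebra to its restricted enveloping algebra. -/
noncomputable def envelopingι : L →ₗ[K] RestrictedEnvelopingAlgebra p K L :=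
  (RingQuot.mkAlgHom K (EnvelopingRel p K L)).toLinearMap ∘ₗ
    (UniversalEnvelopingAlgebra.ι K : L →ₗ⁅K⁆ UniversalEnvelopingAlgebra K L).toLinearMap

theorem envelopingι_apply (z : L) : envelopingι p K L z =
    RingQuot.mkAlgHom K (EnvelopingRel p K L) (UniversalEnvelopingAlgebra.ι K z) := rfl

theorem envelopingι_pow (z : L) :
    envelopingι p K L z ^ p = envelopingι p K L (pmap p K z) := by
  rw [envelopingι_apply, envelopingι_apply, ← map_pow]
  exact RingQuot.mkAlgHom_rel K (EnvelopingRel.pow_eq z)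

theorem adjoin_range_envelopingι :
    Algebra.adjoin K (Set.range (envelopingι p K L)) = ⊤ := by
  let π : TensorAlgebra K L →ₐ[K] RestrictedEnvelopingAlgebra p K L :=
    (RingQuot.mkAlgHom K (EnvelopingRel p K L)).comp (UniversalEnvelopingAlgebra.mkAlgHom K L)
  have hπ : Function.Surjective π := by
    refine (RingQuot.mkAlgHom_surjective K _).comp ?_
    exact fun y => Quotient.exists_rep y
  have hrange : Set.range (envelopingι p K L) = π '' Set.range (TensorAlgebra.ι K) := by
    rw [← Set.range_comp]
    rfl
  rw [hrange, ← AlgHom.map_adjoin, TensorAlgebra.adjoin_range_ι, Algebra.map_top,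
    AlgHom.range_eq_top]
  exact hπ

theorem envelopingι_commute [IsLieAbelian L] (y z : L) :
    envelopingι p K L y * envelopingι p K L z = envelopingι p K L z * envelopingι p K L y := by
  have h : ⁅(UniversalEnvelopingAlgebra.ι K y : UniversalEnvelopingAlgebra K L),
      UniversalEnvelopingAlgebra.ι K z⁆ = 0 := by
    rw [← LieHom.map_lie, trivial_lie_zero, map_zero]
  rw [LieRing.of_associative_ring_bracket, sub_eq_zero] at h
  simp only [envelopingι_apply, ← map_mul, h]

theorem restrictedEnvelopingAlgebra_mul_comm [IsLieAbelian L]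
    (a b : RestrictedEnvelopingAlgebra p K L) : a * b = b * a := by
  have key (c : RestrictedEnvelopingAlgebra p K L) :
      c ∈ Algebra.adjoin K (Set.range (envelopingι p K L)) := by
    rw [adjoin_range_envelopingι]
    trivial
  refine Algebra.commute_of_mem_adjoin_of_forall_mem_commute (key b) fun y hy => ?_
  refine (Algebra.commute_of_mem_adjoin_of_forall_mem_commute (key a) fun z hz => ?_).symm
  obtain ⟨y, rfl⟩ := hy
  obtain ⟨z, rfl⟩ := hz
  exact envelopingι_commute p K L y z

end Enveloping

/-- In characteristic two, if the power mapping of an abelian restricted Lie algebra takes values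
in the line through a toral element, then the restricted enveloping algebra is semiperfect. -/
theorem isSemiperfectRing_of_pmap_mem_toral_line (K : Type u) [Field K] [CharP K 2]
    (L : Type v) [LieRing L] [LieAlgebra K L] [RestrictedLieAlgebra 2 K L] [IsLieAbelian L]
    {x : L} (hx : pmap 2 K x = x) (h : ∀ z : L, ∃ c : K, pmap 2 K z = c • x) :
    IsSemiperfectRing (RestrictedEnvelopingAlgebra 2 K L) := by
  set X := envelopingι 2 K L x with hX
  have hcomm := restrictedEnvelopingAlgebra_mul_comm 2 K L
  have hXX : X * X = X := by
    rw [← pow_two, hX, envelopingι_pow, hx]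
  have htwo (a : RestrictedEnvelopingAlgebra 2 K L) : a + a = 0 := by
    rw [← one_smul K a, ← add_smul, CharTwo.add_self_eq_zero, zero_smul]
  refine isSemiperfectRing_of_commute_of_sq_mem_span_idempotents (K := K) hcomm hXX fun r => ?_
  have hr : r ∈ Algebra.adjoin K (Set.range (envelopingι 2 K L)) := by
    rw [adjoin_range_envelopingι]
    trivial
  -- The set of `r` with `r ^ 2` in `K(1 - X) + KX` contains the generators and is closed under sums
  -- and products, since that span is a subring and squaring is a ring homomorphism.
  induction hr using Algebra.adjoin_induction with
  | mem r hr =>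
    obtain ⟨z, rfl⟩ := hr
    obtain ⟨c, hc⟩ := h z
    exact ⟨0, c, by rw [envelopingι_pow, hc, map_smul, zero_smul, zero_add]⟩
  | algebraMap c =>
    refine ⟨c ^ 2, c ^ 2, ?_⟩
    rw [← smul_add, sub_add_cancel, ← map_pow, Algebra.algebraMap_eq_smul_one]
  | add a b _ _ ha hb =>
    obtain ⟨γ, δ, ha⟩ := ha
    obtain ⟨γ', δ', hb⟩ := hb
    refine ⟨γ + γ', δ + δ', ?_⟩
    have : (a + b) ^ 2 = a ^ 2 + b ^ 2 := by
      rw [pow_two, add_mul, mul_add, mul_add, hcomm b a, pow_two, pow_two,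
        show a * a + a * b + (a * b + b * b) = a * a + b * b + (a * b + a * b) by abel, htwo,
        add_zero]
    rw [this, ha, hb, add_smul, add_smul]
    abel
  | mul a b _ _ ha hb =>
    obtain ⟨γ, δ, ha⟩ := ha
    obtain ⟨γ', δ', hb⟩ := hb
    refine ⟨γ * γ', δ * δ', ?_⟩
    have hXi : IsIdempotentElem X := hXX
    rw [(show Commute a b from hcomm a b).mul_pow, ha, hb]
    simp only [add_mul, mul_add, smul_mul_smul_comm, hXi.eq, hXi.one_sub.eq, hXi.mul_one_sub_self,
      hXi.one_sub_mul_self, smul_zero, add_zero, zero_add]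

end RestrictedLieAlgebra

/-! ### Anisotropy of the diagonal form -/

namespace RatFuncNat

variable (F : Type u) [Field F]

/-- The coefficients `1, t_0, t_1, …` of the power mapping. -/
noncomputable def coeff : Option ℕ → RatFuncNat F
  | none => 1
  | some i => t F i

/-- The diagonal form `∑ aᵢ² sᵢ` with `s = (1, t_0, t_1, …)`. -/
noncomputable def diagForm (z : Option ℕ →₀ RatFuncNat F) : RatFuncNat F :=
  z.sum fun i c => c ^ 2 * coeff F i

variable {F}

theorem diagForm_single (i : Option ℕ) (c : RatFuncNat F) :
    diagForm F (Finsupp.single i c) = c ^ 2 * coeff F i :=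
  Finsupp.sum_single_index (by simp)

theorem diagForm_smul (c : RatFuncNat F) (z : Option ℕ →₀ RatFuncNat F) :
    diagForm F (c • z) = c ^ 2 * diagForm F z := by
  rw [diagForm, Finsupp.sum_smul_index (by simp), diagForm, Finsupp.mul_sum]
  exact Finsupp.sum_congr fun i _ => by ring

variable [CharP F 2]

theorem diagForm_add (y z : Option ℕ →₀ RatFuncNat F) :
    diagForm F (y + z) = diagForm F y + diagForm F z :=
  Finsupp.sum_add_index' (by simp) fun i a b => by rw [CharTwo.add_sq, add_mul]

/-- In characteristic 2, squares are constants for every derivation. -/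
theorem pderiv_sq_mul (j : ℕ) (g f : MvPolynomial ℕ F) :
    MvPolynomial.pderiv j (g ^ 2 * f) = g ^ 2 * MvPolynomial.pderiv j f := by
  rw [MvPolynomial.pderiv_mul, MvPolynomial.pderiv_pow, Nat.cast_ofNat, CharTwo.two_eq_zero]
  ring

/-- The elements `1, t_0, t_1, …` are linearly independent over the subfield of squares. -/
theorem eq_zero_of_diagForm_eq_zero {z : Option ℕ →₀ RatFuncNat F} (hz : diagForm F z = 0) :
    z = 0 := by
  classical
  -- Clear denominators, so that the relation lives among polynomials, where `pderiv` acts.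
  obtain ⟨d, hd⟩ := IsLocalization.exist_integer_multiples
    (nonZeroDivisors (MvPolynomial ℕ F)) z.support z
  choose! g hg using hd
  have hd0 : algebraMap (MvPolynomial ℕ F) (RatFuncNat F) d ≠ 0 :=
    IsFractionRing.to_map_ne_zero_of_mem_nonZeroDivisors d.2
  let s : Option ℕ → MvPolynomial ℕ F := fun o => o.elim 1 MvPolynomial.X
  have hs (o : Option ℕ) : algebraMap _ (RatFuncNat F) (s o) = coeff F o := by
    cases o
    · exact map_one _
    · rfl
  have hsum : ∑ i ∈ z.support, g i ^ 2 * s i = 0 := by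
    apply IsFractionRing.injective (MvPolynomial ℕ F) (RatFuncNat F)
    rw [map_sum, map_zero, ← mul_zero (algebraMap _ (RatFuncNat F) (d : MvPolynomial ℕ F) ^ 2),
      ← hz, diagForm, Finsupp.sum, Finset.mul_sum]
    refine Finset.sum_congr rfl fun i hi => ?_
    rw [map_mul, map_pow, hg i hi, hs, Algebra.smul_def]
    ring
  -- Applying `∂/∂t_j` to the relation leaves only `g (some j) ^ 2`.
  have hsome (j : ℕ) : z (some j) = 0 := by
    by_contra hj
    have h := congrArg (MvPolynomial.pderiv j) hsum
    simp only [map_sum, map_zero, pderiv_sq_mul] at h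
    rw [Finset.sum_eq_single_of_mem (some j) (by simpa using hj)] at h
    · have hgj : g (some j) = 0 := by simpa [s] using h
      have := hg (some j) (by simpa using hj)
      rw [hgj, map_zero, Algebra.smul_def] at this
      exact (mul_ne_zero hd0 hj) this.symm
    · rintro (_ | i) _ hne
      · simp [s]
      · have : i ≠ j := fun h => hne (congrArg some h)
        simp [s, MvPolynomial.pderiv_X_of_ne this]
  have hsingle : z = Finsupp.single none (z none) := by
    ext (_ | i)
    · simp
    · simp [hsome]
  rw [hsingle, diagForm_single] at hz
  rw [hsingle, (by simpa [coeff] using hz : z none = 0), Finsupp.single_zero]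

variable (F)

/-- If `a ^ 2 = t_0`, then `a e_none + e_0` is a nonzero isotropic vector. -/
theorem not_perfectField : ¬ PerfectField (RatFuncNat F) := by
  intro h
  obtain ⟨a, ha⟩ := (PerfectRing.bijective_frobenius (R := RatFuncNat F) (p := 2)).2 (t F 0)
  have h0 : diagForm F (Finsupp.single none a + Finsupp.single (some 0) 1) = 0 := by
    rw [diagForm_add, diagForm_single, diagForm_single]
    have : a ^ 2 = t F 0 := ha
    simp [coeff, this, CharTwo.add_self_eq_zero]
  have h1 := DFunLike.congr_fun (eq_zero_of_diagForm_eq_zero h0) (some 0)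
  simp at h1

end RatFuncNat

/-! ### The example -/

/-- The abelian restricted Lie algebra with basis `x, y_0, y_1, …`, `x^[2] = x` and
`y_i^[2] = t_i x`. -/
def ToralLineAlgebra (F : Type u) [Field F] : Type u := Option ℕ →₀ RatFuncNat F

namespace ToralLineAlgebra

open RatFuncNat RestrictedLieAlgebra

variable (F : Type u) [Field F]

noncomputable instance : AddCommGroup (ToralLineAlgebra F) :=
  inferInstanceAs (AddCommGroup (Option ℕ →₀ RatFuncNat F))

noncomputable instance : Module (RatFuncNat F) (ToralLineAlgebra F) :=
  inferInstanceAs (Module (RatFuncNat F) (Option ℕ →₀ RatFuncNat F))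

noncomputable instance : LieRing (ToralLineAlgebra F) where
  bracket _ _ := 0
  add_lie _ _ _ := (add_zero 0).symm
  lie_add _ _ _ := (add_zero 0).symm
  lie_self _ := rfl
  leibniz_lie _ _ _ := (add_zero 0).symm

noncomputable instance : LieAlgebra (RatFuncNat F) (ToralLineAlgebra F) where
  lie_smul c _ _ := (smul_zero c).symm

instance : IsLieAbelian (ToralLineAlgebra F) where
  trivial _ _ := rfl

/-- The basis `x, y_0, y_1, …`. -/
noncomputable def basis : Module.Basis (Option ℕ) (RatFuncNat F) (ToralLineAlgebra F) :=
  .ofRepr (LinearEquiv.refl (RatFuncNat F) (Option ℕ →₀ RatFuncNat F))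

theorem not_finite : ¬ Module.Finite (RatFuncNat F) (ToralLineAlgebra F) := fun _ =>
  not_finite_iff_infinite.2 (inferInstance : Infinite (Option ℕ))
    (Module.Finite.finite_basis (basis F))

variable [CharP F 2]

noncomputable instance : RestrictedLieAlgebra 2 (RatFuncNat F) (ToralLineAlgebra F) where
  pmap z := diagForm F z • basis F none
  ad_pmap z := by
    have h (w : ToralLineAlgebra F) : LieAlgebra.ad (RatFuncNat F) _ w = 0 := by
      ext y
      exact trivial_lie_zero _ _ w y
    rw [h, h, zero_pow two_ne_zero]
  pmap_smul c z := by
    rw [smul_smul]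
    exact congrArg (· • basis F none) (diagForm_smul c z)
  pmap_add a b := by
    -- For `p = 2` Jacobson's correction is the single term `⁅b, a⁆`.
    have h : lieAdPowCoeff a b 1 0 = 0 := trivial_lie_zero _ _ b a
    simp only [Nat.add_one_sub_one, Finset.Icc_self, Finset.sum_singleton, Nat.sub_self, h,
      smul_zero, add_zero]
    rw [← add_smul]
    exact congrArg (· • basis F none) (diagForm_add a b)

theorem pmap_def (z : ToralLineAlgebra F) :
    pmap 2 (RatFuncNat F) z = diagForm F z • basis F none := rfl

theorem pmap_basis (i : Option ℕ) :
    pmap 2 (RatFuncNat F) (basis F i) = coeff F i • basis F none := by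
  have h : diagForm F (basis F i) = coeff F i := by
    rw [show (basis F i : Option ℕ →₀ RatFuncNat F) = Finsupp.single i 1 from rfl,
      diagForm_single, one_pow, one_mul]
  rw [pmap_def, h]

theorem pmap_basis_none : pmap 2 (RatFuncNat F) (basis F none) = basis F none := by
  rw [pmap_basis, coeff, one_smul]

theorem eq_zero_of_pmap_eq_zero {z : ToralLineAlgebra F} (hz : pmap 2 (RatFuncNat F) z = 0) :
    z = 0 := by
  rw [pmap_def, smul_eq_zero_iff_left ((basis F).ne_zero none)] at hz
  exact eq_zero_of_diagForm_eq_zero hz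

theorem eq_zero_of_isPNilpotent {z : ToralLineAlgebra F}
    (hz : IsPNilpotent 2 (RatFuncNat F) _ z) : z = 0 := by
  obtain ⟨n, hn⟩ := hz
  induction n with
  | zero => exact hn
  | succ n ih =>
    rw [Function.iterate_succ_apply'] at hn
    exact ih (eq_zero_of_pmap_eq_zero F hn)

theorem pCore_eq_bot : pCore 2 (RatFuncNat F) (ToralLineAlgebra F) = ⊥ := by
  refine eq_bot_iff.2 (sSup_le fun I hI z hz => ?_)
  rw [LieSubmodule.mem_bot]
  exact eq_zero_of_isPNilpotent F (hI.2 z hz)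

theorem isLocallyFiniteDimensional :
    IsLocallyFiniteDimensional 2 (RatFuncNat F) (ToralLineAlgebra F) := by
  intro s hs
  -- Adjoining `x` to the span makes it closed under the power mapping, whose values are all
  -- multiples of `x`.
  let V := Submodule.span (RatFuncNat F) (insert (basis F none) s)
  let H : LieSubalgebra (RatFuncNat F) (ToralLineAlgebra F) :=
    { V with lie_mem' := fun {y z} _ _ => by
              rw [trivial_lie_zero]
              exact V.zero_mem }
  have hle : restrictedSpan 2 (RatFuncNat F) (ToralLineAlgebra F) s ≤ H :=
    sInf_le ⟨fun z hz => Submodule.subset_span (Set.mem_insert_of_mem _ hz),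
      fun z _ => V.smul_mem _ (Submodule.subset_span (Set.mem_insert _ _))⟩
  have : Module.Finite (RatFuncNat F) V := Module.Finite.span_of_finite _ (hs.insert _)
  exact Submodule.finiteDimensional_of_le (S₂ := V) hle

theorem isSemiperfectRing :
    IsSemiperfectRing (RestrictedEnvelopingAlgebra 2 (RatFuncNat F) (ToralLineAlgebra F)) :=
  isSemiperfectRing_of_pmap_mem_toral_line (RatFuncNat F) (ToralLineAlgebra F)
    (pmap_basis_none F) fun z => ⟨_, pmap_def F z⟩

theorem not_finite_quotient_pCore : ¬ Module.Finite (RatFuncNat F)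
    (ToralLineAlgebra F ⧸ pCore 2 (RatFuncNat F) (ToralLineAlgebra F)) := by
  rw [pCore_eq_bot]
  intro h
  refine not_finite F ?_
  have h' : Module.Finite (RatFuncNat F)
    (ToralLineAlgebra F ⧸ (⊥ : Submodule (RatFuncNat F) (ToralLineAlgebra F))) := h
  exact Module.Finite.equiv (Submodule.quotEquivOfEqBot _ rfl)

end ToralLineAlgebra

open RestrictedLieAlgebra in
theorem theorem2p10 (F : Type u) [Field F] [CharP F 2] :
    ¬ PerfectField (RatFuncNat F) ∧
    ∃ (L : Type u) (_ : LieRing L) (_ : LieAlgebra (RatFuncNat F) L)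
      (_ : RestrictedLieAlgebra 2 (RatFuncNat F) L)
      (b : Module.Basis (Option ℕ) (RatFuncNat F) L),
      IsLieAbelian L ∧
      pmap 2 (RatFuncNat F) (b none) = b none ∧
      (∀ i : ℕ, pmap 2 (RatFuncNat F) (b (some i)) = RatFuncNat.t F i • b none) ∧
      ¬ Module.Finite (RatFuncNat F) L ∧
      IsLocallyFiniteDimensional 2 (RatFuncNat F) L ∧
      IsSemiperfectRing (RestrictedEnvelopingAlgebra 2 (RatFuncNat F) L) ∧
      pCore 2 (RatFuncNat F) L = ⊥ ∧
      ¬ Module.Finite (RatFuncNat F) (L ⧸ pCore 2 (RatFuncNat F) L) :=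
  ⟨RatFuncNat.not_perfectField F, ToralLineAlgebra F, inferInstance, inferInstance, inferInstance,
    ToralLineAlgebra.basis F, inferInstance, ToralLineAlgebra.pmap_basis_none F,
    fun i => ToralLineAlgebra.pmap_basis F (some i), ToralLineAlgebra.not_finite F,
    ToralLineAlgebra.isLocallyFiniteDimensional F, ToralLineAlgebra.isSemiperfectRing F,
    ToralLineAlgebra.pCore_eq_bot F, ToralLineAlgebra.not_finite_quotient_pCore F⟩
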